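/- A well-quasi-order (wqo) is a quasi-order $(A,\le)$ in which every infinite sequence $(x_i)_{i\in\mathbb N}$ has a pair $i<j$ with $x_i\le x_j$. The \emph{width} $\mathbf w(A)$ of a wqo $A$ is the ordinal rank of the root (the empty sequence) in the well-founded tree of finite sequences of pairwise incomparable elements of $A$, ordered by inverse prefix order; here the rank of a node $s$ is $\sup\{r(t)+1 : s \text{ is a proper prefix of } t\}$. Let $\mathsf P_f(A)$ be the set of finite subsets of $A$ with the Hoare embedding $S\sqsubseteq S' \iff \forall a\in S\ \exists b\in S'\ a\le b$ (again a wqo), let $\Gamma_k$ be an antichain with $k$ elements, and let $\sqcup$ denote disjoint sum. Exponentiation is ordinal exponentiation. \textbf{Theorem.} Let $A$ be a wqo. \begin{enumerate} \item If $\mathbf w(A)$ is infinite, then $\mathbf w(\mathsf P_f(A))\ge 2^{\mathbf w(A)}$. \item If $\mathbf w(A)=k<\omega$, then $\mathbf w(\mathsf P_f(A))\ge \mathbf w(\mathsf P_f(\Gamma_k))$. \end{enumerate} Moreover, $\mathbf w(\mathsf P_f(A))$ has no upper bound in terms of $\mathbf w(A)$: for every infinite ordinal $\alpha$ the wqo $A_\alpha=\omega\sqcup\alpha$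 satisfies $\mathbf w(A_\alpha)=2$ and $\mathbf w(\mathsf P_f(A_\alpha))=\alpha$; in particular there is no function $f$ from ordinals to ordinals such that $\mathbf w(\mathsf P_f(A))\le f(\mathbf w(A))$ for all wqos $A$. -/

import Mathlib

universe u

/-- Antichain sequences of `A`: finite sequences of pairwise incomparable elements. -/
def AntichainSeq (A : Type u) [Preorder A] : Type u :=
  {l : List A // l.Pairwise (IncompRel (· ≤ ·))}

namespace AntichainSeq

/-- `Below t s`: `t` lies strictly below `s` in the tree `Inco(A)` of antichain sequences ordered
by inverse prefix order, i.e. `s` is a proper prefix of `t`. -/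
def Below {A : Type u} [Preorder A] (t s : AntichainSeq A) : Prop :=
  s.1 <+: t.1 ∧ s.1 ≠ t.1

/-- The empty sequence, root of the tree. -/
def root (A : Type u) [Preorder A] : AntichainSeq A := ⟨[], List.Pairwise.nil⟩

theorem Below.length_lt {A : Type u} [Preorder A] {t s : AntichainSeq A} (h : Below t s) :
    s.1.length < t.1.length :=
  lt_of_le_of_ne h.1.length_le fun e => h.2 (h.1.eq_of_length e)

/-- The tree of antichain sequences of a well-quasi-order has no infinite branch. -/
instance isWellFounded_below (A : Type u) [Preorder A] [WellQuasiOrderedLE A] :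
    IsWellFounded (AntichainSeq A) Below := by
  refine ⟨wellFounded_iff_isEmpty_descending_chain.2 ⟨fun ⟨f, hf⟩ => ?_⟩⟩
  have hlen : ∀ n, n ≤ (f n).1.length := by
    intro n
    induction n with
    | zero => exact Nat.zero_le _
    | succ n ih => exact lt_of_le_of_lt ih (hf n).length_lt
  have hpre : ∀ m n, m ≤ n → (f m).1 <+: (f n).1 := by
    intro m n h
    induction n, h using Nat.le_induction with
    | base => exact List.prefix_rfl
    | succ n _ ih => exact ih.trans (hf n).1
  obtain ⟨m, n, hmn, hle⟩ := wellQuasiOrdered_le (α := A)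
    fun n => (f (n + 1)).1[n]'(hlen (n + 1))
  have hm : m < (f (n + 1)).1.length := hmn.trans (hlen (n + 1))
  have key := List.pairwise_iff_getElem.1 (f (n + 1)).2 m n hm (hlen (n + 1)) hmn
  have e := (hpre (m + 1) (n + 1) (by omega)).getElem (hlen (m + 1))
  rw [← e] at key
  exact key.1 hle

end AntichainSeq

/-- The width of a well-quasi-order: the ordinal rank of the root of its tree of antichain
sequences. -/
noncomputable def width (A : Type u) [Preorder A] [WellQuasiOrderedLE A] : Ordinal.{u} :=
  IsWellFounded.rank AntichainSeq.Below (AntichainSeq.root A)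

/-- The finitary powerset of `A`, to be ordered by Hoare embedding rather than by inclusion. -/
def Pf (A : Type u) : Type u := Finset A

namespace Pf

instance instMembership (A : Type u) : Membership A (Pf A) :=
  inferInstanceAs (Membership A (Finset A))

instance instPreorder (A : Type u) [Preorder A] : Preorder (Pf A) where
  le S T := ∀ a ∈ S, ∃ b ∈ T, a ≤ b
  le_refl _ a ha := ⟨a, ha, le_refl a⟩
  le_trans _ _ _ hST hTU a ha := by
    obtain ⟨b, hb, hab⟩ := hST a ha
    obtain ⟨c, hc, hbc⟩ := hTU b hb
    exact ⟨c, hc, hab.trans hbc⟩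

/-- The finitary powerset of a well-quasi-order is a well-quasi-order. -/
instance instWellQuasiOrderedLE (A : Type u) [Preorder A] [WellQuasiOrderedLE A] :
    WellQuasiOrderedLE (Pf A) := by
  refine ⟨fun f => ?_⟩
  have h : (Set.univ : Set A).PartiallyWellOrderedOn (· ≤ ·) :=
    Set.partiallyWellOrderedOn_univ_iff.2 wellQuasiOrdered_le
  obtain ⟨m, n, hmn, hle⟩ :=
    (h.partiallyWellOrderedOn_sublistForall₂ (· ≤ ·)).exists_lt
      (f := fun n => Finset.toList (α := A) (f n)) (fun _ _ _ => Set.mem_univ _)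
  refine ⟨m, n, hmn, fun a ha => ?_⟩
  obtain ⟨l, hl, hsub⟩ := List.sublistForall₂_iff.1 hle
  obtain ⟨i, hi, rfl⟩ := List.getElem_of_mem (Finset.mem_toList.2 ha)
  have hi' : i < l.length := hl.length_eq ▸ hi
  exact ⟨l[i], Finset.mem_toList.1 (hsub.subset (List.getElem_mem hi')), hl.get hi hi'⟩

end Pf

/-- The antichain with `k` elements. -/
def Gam (k : ℕ) : Type := Fin k

namespace Gam

instance instFinite (k : ℕ) : Finite (Gam k) := inferInstanceAs (Finite (Fin k))

instance instPreorder (k : ℕ) : Preorder (Gam k) where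
  le a b := a = b
  le_refl _ := rfl
  le_trans _ _ _ := Eq.trans

instance instWellQuasiOrderedLE (k : ℕ) : WellQuasiOrderedLE (Gam k) :=
  Finite.to_wellQuasiOrderedLE

end Gam

/-- The disjoint sum of two well-quasi-orders is a well-quasi-order. -/
instance instWellQuasiOrderedLESum (A B : Type*) [Preorder A] [Preorder B]
    [WellQuasiOrderedLE A] [WellQuasiOrderedLE B] : WellQuasiOrderedLE (A ⊕ B) := by
  refine ⟨Set.partiallyWellOrderedOn_univ_iff.1 ?_⟩
  have hA : (Set.univ : Set A).PartiallyWellOrderedOn (· ≤ ·) :=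
    Set.partiallyWellOrderedOn_univ_iff.2 wellQuasiOrdered_le
  have hB : (Set.univ : Set B).PartiallyWellOrderedOn (· ≤ ·) :=
    Set.partiallyWellOrderedOn_univ_iff.2 wellQuasiOrdered_le
  have hA' := hA.image_of_monotone_on (r' := ((· ≤ ·) : A ⊕ B → A ⊕ B → Prop)) (f := Sum.inl)
    fun _ _ _ _ h => Sum.inl_le_inl_iff.2 h
  have hB' := hB.image_of_monotone_on (r' := ((· ≤ ·) : A ⊕ B → A ⊕ B → Prop)) (f := Sum.inr)
    fun _ _ _ _ h => Sum.inr_le_inr_iff.2 h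
  have := hA'.union hB'
  rwa [Set.image_univ, Set.image_univ, Set.range_inl_union_range_inr] at this

/-!
Lower bounds on widths are handled by the predicate `WidthAtLeast α C` on subsets `C`, which unfolds
the rank of the tree of antichain sequences: for every `β < α` some `x ∈ C` leaves width at least
`β` among the elements of `C` incomparable to `x`. For all of a well-quasi-order `A` it says
`α ≤ width A` (`widthAtLeast_univ_iff`).

*The exponential bound.* Write `width A = ω · a + n` with `a ≠ 0`, so that
`2 ^ width A = ω ^ a · 2 ^ n`. There are an antichain `X` of `n` elements and a set `C`, incomparable
to `X`, of width at least `ω · a`.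

The factor `ω ^ a` comes by induction on `a`: if `m` incomparable elements `x` leave width `ω · b`,
then the sets `{x} ∪ S` form `m` mutually incomparable classes of width `ω ^ b` each
(`Pf.widthAtLeast_omega0_opow`).

The factor `2 ^ n` comes from the sets `Y ∪ S` with `Y ⊆ X` and `S ⊆ C`. The classes for different
`Y` have to be played one after the other, starting from a maximal `Y`, and a set played later must
not lie above a set played earlier, nor below it. For `Y ∪ S` and a later `Z ∪ T` the first is
ensured by `Y ⊄ Z`; the second holds as soon as `T` has an element below no element played before.
So finitely many principal lower cones have to be avoided without loss of width. This is possible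
after shrinking `C` to a subset `D` that is minimal, with respect to the removal of principal upper
cones, among those of width at least `ω · a`. An antichain meeting the strict cone below `t` does
not meet the cone above `t`, and `D` without the latter has smaller width; hence the width of `D` is
attained outside the cone below `t` (`WidthAtLeast.exists_diff_lowerClosure`,
`Pf.widthAtLeast_mul_card_family`).

*Finite width.* A width of `k` yields an antichain of `k` elements, hence an embedding of the
powerset of `Gam k`.

*The sums `ℕ ⊕ α`.* Up to equivalence a finite subset is the pair of its suprema, so the width is that
of `ℕ × α`. It is at most `α` because the removal of a chain lowers a width by at most one
(`WidthAtLeast.diff_chain`, `WidthAtLeast.le_of_nat_prod`). Since `ℕ ⊕ α` has width two for every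
`α`, no function of the width bounds the width of the powerset.
-/

universe v w

/-! ### Lower bounds on the width of a subset -/

/-- `WidthAtLeast α C` says that the subset `C` has width at least `α`: for every
`β < α` some element of `C` leaves a width of at least `β` among the elements of `C` incomparable to
it. The ordinal may live in any universe. -/
def WidthAtLeast {P : Type u} [Preorder P] (α : Ordinal.{v}) (C : Set P) : Prop :=
  ∀ β, β < α → ∃ x ∈ C, WidthAtLeast β {y ∈ C | IncompRel (· ≤ ·) x y}
termination_by α

theorem widthAtLeast_iff {P : Type u} [Preorder P] {α : Ordinal.{v}} {C : Set P} :
    WidthAtLeast α C ↔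
      ∀ β, β < α → ∃ x ∈ C, WidthAtLeast β {y ∈ C | IncompRel (· ≤ ·) x y} := by
  rw [WidthAtLeast]

namespace WidthAtLeast

variable {P : Type u} {Q : Type w} [Preorder P] [Preorder Q]

theorem zero (C : Set P) : WidthAtLeast (0 : Ordinal.{v}) C :=
  widthAtLeast_iff.2 fun _ h => absurd h (not_lt_of_ge (zero_le))

theorem anti {α β : Ordinal.{v}} {C : Set P} (h : WidthAtLeast α C) (hβ : β ≤ α) :
    WidthAtLeast β C :=
  widthAtLeast_iff.2 fun γ hγ => widthAtLeast_iff.1 h γ (hγ.trans_le hβ)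

/-- Maps that preserve incomparability preserve lower bounds on the width. -/
theorem map {α : Ordinal.{v}} {C : Set P} {C' : Set Q} (f : P → Q)
    (h : WidthAtLeast α C) (hf : ∀ x ∈ C, f x ∈ C')
    (hinc : ∀ x ∈ C, ∀ y ∈ C, IncompRel (· ≤ ·) x y → IncompRel (· ≤ ·) (f x) (f y)) :
    WidthAtLeast α C' := by
  induction α using WellFoundedLT.induction generalizing C C' with
  | ind α ih =>
    refine widthAtLeast_iff.2 fun β hβ => ?_
    obtain ⟨x, hx, hxβ⟩ := widthAtLeast_iff.1 h β hβ
    exact ⟨f x, hf x hx, ih β hβ hxβ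
      (fun y hy => ⟨hf y hy.1, hinc x hx y hy.1 hy.2⟩)
      fun y hy z hz => hinc y hy.1 z hz.1⟩

theorem mono {α : Ordinal.{v}} {C C' : Set P} (h : WidthAtLeast α C) (hC : C ⊆ C') :
    WidthAtLeast α C' :=
  h.map id hC fun _ _ _ _ => id

theorem lift {α : Ordinal.{v}} {C : Set P} (h : WidthAtLeast α C) :
    WidthAtLeast (Ordinal.lift.{w} α) C := by
  induction α using WellFoundedLT.induction generalizing C with
  | ind α ih =>
    refine widthAtLeast_iff.2 fun β hβ => ?_
    obtain ⟨β, rfl⟩ := Ordinal.mem_range_lift_of_le hβ.le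
    obtain ⟨x, hx, hxβ⟩ := widthAtLeast_iff.1 h β (Ordinal.lift_lt.1 hβ)
    exact ⟨x, hx, ih β (Ordinal.lift_lt.1 hβ) hxβ⟩

theorem of_forall_succ {α : Ordinal.{v}} {C : Set P}
    (h : ∀ β < α, WidthAtLeast (Order.succ β) C) : WidthAtLeast α C :=
  widthAtLeast_iff.2 fun β hβ => widthAtLeast_iff.1 (h β hβ) β (Order.lt_succ β)

/-- Removing a chain lowers the width by at most one, since an antichain sequence meets it at most
once. -/
theorem diff_chain {α : Ordinal.{v}} {C V : Set P}
    (hV : ∀ x ∈ V, ∀ y ∈ V, ¬ IncompRel (· ≤ ·) x y) (h : WidthAtLeast (Order.succ α) C) :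
    WidthAtLeast α (C \ V) := by
  induction α using WellFoundedLT.induction generalizing C with
  | ind α ih =>
    obtain ⟨x, hx, hxα⟩ := widthAtLeast_iff.1 h α (Order.lt_succ α)
    by_cases hxV : x ∈ V
    · exact hxα.mono fun y hy => ⟨hy.1, fun hyV => hV x hxV y hyV hy.2⟩
    · refine widthAtLeast_iff.2 fun β hβ => ⟨x, ⟨hx, hxV⟩, ?_⟩
      exact (ih β hβ (hxα.anti (Order.succ_le_of_lt hβ))).mono
        fun y hy => ⟨⟨hy.1.1, hy.2⟩, hy.1.2⟩

theorem diff_iUnion_chain {α : Ordinal.{v}} {C : Set P} (V : ℕ → Set P)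
    (hV : ∀ i, ∀ x ∈ V i, ∀ y ∈ V i, ¬ IncompRel (· ≤ ·) x y) (n : ℕ)
    (h : WidthAtLeast (α + n) C) : WidthAtLeast α (C \ ⋃ i < n, V i) := by
  induction n generalizing C with
  | zero => simpa using h
  | succ n ih =>
    rw [Nat.cast_succ, ← add_assoc, ← Order.succ_eq_add_one] at h
    refine (ih (h.diff_chain (hV n))).mono fun x hx => ⟨hx.1.1, fun hmem => ?_⟩
    simp only [Set.mem_iUnion] at hmem
    obtain ⟨i, hi, hxi⟩ := hmem
    rcases Nat.lt_succ_iff_lt_or_eq.1 hi with hi | rfl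
    · exact hx.2 (Set.mem_iUnion₂.2 ⟨i, hi, hxi⟩)
    · exact hx.1.2 hxi

/-- Ordinal sums of widths: if `E ⊆ C` has width at least `β`, and any finitely many
elements of `E` leave a width of at least `γ` among the elements of `C` incomparable to them, then
`C` has width at least `γ + β`. -/
theorem add {β γ : Ordinal.{v}} {E C : Set P} (hE : WidthAtLeast β E) (hEC : E ⊆ C)
    (hC : ∀ G : Set P, G.Finite → G ⊆ E →
      WidthAtLeast γ {y ∈ C | ∀ x ∈ G, IncompRel (· ≤ ·) x y}) :
    WidthAtLeast (γ + β) C := by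
  induction β using WellFoundedLT.induction generalizing E C with
  | ind β ih =>
    refine widthAtLeast_iff.2 fun δ hδ => ?_
    rcases lt_or_ge δ γ with hδγ | hγδ
    · obtain ⟨x, hx, hxδ⟩ := widthAtLeast_iff.1
        ((hC ∅ Set.finite_empty (Set.empty_subset _)).mono fun y hy => hy.1) δ hδγ
      exact ⟨x, hx, hxδ⟩
    · obtain ⟨ε, rfl⟩ := exists_add_of_le hγδ
      have hε : ε < β := (add_lt_add_iff_left γ).1 hδ
      obtain ⟨x, hx, hxε⟩ := widthAtLeast_iff.1 hE ε hε
      refine ⟨x, hEC hx, ih ε hε hxε (fun y hy => ⟨hEC hy.1, hy.2⟩) fun G hG hGE => ?_⟩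
      refine (hC (insert x G) (hG.insert x) (Set.insert_subset hx fun y hy => (hGE hy).1)).mono ?_
      exact fun y hy => ⟨⟨hy.1, hy.2 x (Set.mem_insert _ _)⟩,
        fun z hz => hy.2 z (Set.mem_insert_of_mem _ hz)⟩

/-- A width of at least `α + n` allows an antichain of `n` elements after which a width of `α` is
left. -/
theorem exists_antichain {α : Ordinal.{v}} {C : Set P} (n : ℕ) (h : WidthAtLeast (α + n) C) :
    ∃ X : Finset P, X.card = n ∧ (X : Set P) ⊆ C ∧
      (X : Set P).Pairwise (IncompRel (· ≤ ·)) ∧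
      WidthAtLeast α {y ∈ C | ∀ x ∈ X, IncompRel (· ≤ ·) x y} := by
  classical
  induction n generalizing C with
  | zero => exact ⟨∅, rfl, by simp, by simp, by simpa using h⟩
  | succ n ih =>
    obtain ⟨x, hx, hxα⟩ := widthAtLeast_iff.1 h (α + n) (by
      rw [add_lt_add_iff_left]; exact_mod_cast Nat.lt_succ_self n)
    obtain ⟨X, hcard, hXC, hX, hXα⟩ := ih hxα
    have hxX : x ∉ X := fun hmem => (hXC hmem).2.1 le_rfl
    refine ⟨insert x X, by rw [Finset.card_insert_of_notMem hxX, hcard], ?_, ?_, ?_⟩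
    · rw [Finset.coe_insert]
      exact Set.insert_subset hx fun y hy => (hXC hy).1
    · rw [Finset.coe_insert]
      exact hX.insert fun y hy _ => ⟨(hXC hy).2, (hXC hy).2.symm⟩
    · exact hXα.mono fun y hy => ⟨hy.1.1, fun z hz => by
        rcases Finset.mem_insert.1 hz with rfl | hz
        exacts [hy.1.2, hy.2 z hz]⟩

/-! ### Removing cones -/

/-- An antichain containing an element strictly below `t` contains none above `t`. Hence the width
is attained either outside the cone above `t` or outside the strict cone below `t`. -/
theorem diff_Iio_of_not_diff_Ici {α : Ordinal.{v}} {C : Set P} {t : P} (h : WidthAtLeast α C)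
    (ht : ¬ WidthAtLeast α (C \ Set.Ici t)) : WidthAtLeast α (C \ Set.Iio t) := by
  induction α using WellFoundedLT.induction generalizing C with
  | ind α ih =>
    have ht' := ht
    rw [widthAtLeast_iff] at ht'
    push Not at ht'
    obtain ⟨ε, hε, hxε⟩ := ht'
    refine widthAtLeast_iff.2 fun δ hδ => ?_
    -- a first element with at least `ε` left cannot lie strictly below `t`
    obtain ⟨x, hx, hxδ⟩ := widthAtLeast_iff.1 h (max δ ε) (max_lt hδ hε)
    have key : ¬ x < t := fun hxt => by
      refine hxε x ⟨hx, hxt.not_ge⟩ ((hxδ.anti (le_max_right _ _)).mono ?_)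
      exact fun y hy => ⟨⟨hy.1, fun hty => hy.2.1 (hxt.le.trans hty)⟩, hy.2⟩
    refine ⟨x, ⟨hx, key⟩, ?_⟩
    by_cases htx : t ≤ x
    · exact (hxδ.anti (le_max_left _ _)).mono
        fun y hy => ⟨⟨hy.1, fun hyt => hy.2.2 (hyt.le.trans htx)⟩, hy.2⟩
    · refine ((ih _ (max_lt hδ hε) hxδ fun hbad => ?_).anti (le_max_left _ _)).mono
        fun y hy => ⟨⟨hy.1.1, hy.2⟩, hy.1.2⟩
      exact hxε x ⟨hx, htx⟩ ((hbad.anti (le_max_right _ _)).mono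
        fun y hy => ⟨⟨hy.1.1, hy.2⟩, hy.1.2⟩)

/-- For limit ordinals the full cone below `t` may be removed as well: it differs from the strict
one by the elements equivalent to `t`, which form a chain. -/
theorem diff_Iic_of_not_diff_Ici {α : Ordinal.{v}} {C : Set P} {t : P}
    (hα : Order.IsSuccLimit α) (h : WidthAtLeast α C)
    (ht : ¬ WidthAtLeast α (C \ Set.Ici t)) : WidthAtLeast α (C \ Set.Iic t) := by
  have h1 := h.diff_Iio_of_not_diff_Ici ht
  refine of_forall_succ fun β hβ => ?_
  have h2 := h1.anti (hα.succ_lt (hα.succ_lt hβ)).le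
  refine (h2.diff_chain (V := {x | x ≤ t ∧ t ≤ x}) ?_).mono ?_
  · exact fun x hx y hy hxy => hxy.1 (hx.1.trans hy.2)
  · exact fun x hx => ⟨hx.1.1, fun hxt => hx.1.2 (lt_of_le_not_ge hxt fun htx => hx.2 ⟨hxt, htx⟩)⟩

/-- A set that is minimal, with respect to the removal of principal upper cones, among those of
width at least `α`. -/
theorem exists_minimal [WellQuasiOrderedLE P] {α : Ordinal.{v}} {C : Set P}
    (h : WidthAtLeast α C) :
    ∃ D ⊆ C, WidthAtLeast α D ∧ ∀ t ∈ D, ¬ WidthAtLeast α (D \ Set.Ici t) := by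
  by_contra! hcon
  have : Nonempty P := ⟨(hcon C subset_rfl h).choose⟩
  choose! t ht htα using hcon
  let D : ℕ → Set P := fun n => Nat.rec C (fun _ D => D \ Set.Ici (t D)) n
  have hsucc : ∀ n, D (n + 1) = D n \ Set.Ici (t (D n)) := fun n => rfl
  have hD : ∀ n, D n ⊆ C ∧ WidthAtLeast α (D n) := by
    intro n
    induction n with
    | zero => exact ⟨subset_rfl, h⟩
    | succ n ih => exact ⟨Set.sdiff_subset.trans ih.1, htα _ ih.1 ih.2⟩
  have hanti : Antitone D := antitone_nat_of_succ_le fun n => by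
    rw [hsucc]; exact Set.sdiff_subset
  -- the removed elements form a bad sequence
  obtain ⟨m, n, hmn, hle⟩ := wellQuasiOrdered_le fun n => t (D n)
  have := hanti (Nat.succ_le_of_lt hmn) (ht _ (hD n).1 (hD n).2)
  rw [Nat.succ_eq_add_one, hsucc] at this
  exact this.2 hle

/-- A set of width at least a limit ordinal has a subset whose width stays that large when the
cones below finitely many of its elements are removed. -/
theorem exists_diff_lowerClosure [WellQuasiOrderedLE P] {α : Ordinal.{v}} {C : Set P}
    (hα : Order.IsSuccLimit α) (h : WidthAtLeast α C) :
    ∃ D ⊆ C, ∀ F : Finset P, ↑F ⊆ D → WidthAtLeast α {x ∈ D | ∀ t ∈ F, ¬ x ≤ t} := by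
  classical
  obtain ⟨D, hDC, hD, hmin⟩ := h.exists_minimal
  refine ⟨D, hDC, fun F => ?_⟩
  induction F using Finset.induction_on with
  | empty => intro _; simpa using hD
  | insert t F _ ih =>
    intro hF
    rw [Finset.coe_insert, Set.insert_subset_iff] at hF
    refine ((ih hF.2).diff_Iic_of_not_diff_Ici (t := t) hα fun hbad => hmin t hF.1 ?_).mono ?_
    · exact hbad.mono fun x hx => ⟨hx.1.1, hx.2⟩
    · exact fun x hx => ⟨hx.1.1, fun s hs => by
        rcases Finset.mem_insert.1 hs with rfl | hs
        exacts [hx.2, hx.1.2 s hs]⟩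

end WidthAtLeast

/-! ### Comparison with the rank of the tree of antichain sequences -/

namespace AntichainSeq

variable {A : Type u} [Preorder A]

/-- The elements by which an antichain sequence can be prolonged. -/
def extensions (s : AntichainSeq A) : Set A :=
  {y | ∀ x ∈ s.1, IncompRel (· ≤ ·) x y}

/-- Prolongation of an antichain sequence by one element. -/
def snoc (s : AntichainSeq A) (y : A) (hy : y ∈ s.extensions) : AntichainSeq A :=
  ⟨s.1 ++ [y], List.pairwise_append.2 ⟨s.2, List.pairwise_singleton _ _, fun x hx z hz => by
    rw [List.mem_singleton.1 hz]; exact hy x hx⟩⟩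

theorem extensions_snoc (s : AntichainSeq A) (y : A) (hy : y ∈ s.extensions) :
    (s.snoc y hy).extensions = {z ∈ s.extensions | IncompRel (· ≤ ·) y z} := by
  ext z
  simp only [extensions, snoc, List.mem_append, List.mem_singleton, Set.mem_ofPred_eq]
  constructor
  · exact fun h => ⟨fun x hx => h x (Or.inl hx), h y (Or.inr rfl)⟩
  · rintro ⟨h, hy⟩ x (hx | rfl)
    exacts [h x hx, hy]

theorem snoc_below (s : AntichainSeq A) (y : A) (hy : y ∈ s.extensions) :
    Below (s.snoc y hy) s :=
  ⟨List.prefix_append _ _, fun h => by simp [snoc] at h⟩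

theorem Below.exists_snoc {t s : AntichainSeq A} (h : Below t s) :
    ∃ y, ∃ hy : y ∈ s.extensions, t = s.snoc y hy ∨ Below t (s.snoc y hy) := by
  obtain ⟨⟨l, hl⟩, hne⟩ := h
  cases l with
  | nil => exact absurd (by simpa using hl) hne
  | cons y l =>
    have hp := t.2
    rw [← hl, List.pairwise_append] at hp
    have hy : y ∈ s.extensions := fun x hx => hp.2.2 x hx y List.mem_cons_self
    refine ⟨y, hy, ?_⟩
    by_cases heq : t = s.snoc y hy
    · exact Or.inl heq
    · exact Or.inr ⟨⟨l, by simpa [snoc] using hl⟩, fun h => heq (Subtype.ext h.symm)⟩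

theorem widthAtLeast_extensions_iff [WellQuasiOrderedLE A] {α : Ordinal.{u}}
    {s : AntichainSeq A} :
    WidthAtLeast α s.extensions ↔ α ≤ IsWellFounded.rank Below s := by
  induction α using WellFoundedLT.induction generalizing s with
  | ind α ih =>
    rw [widthAtLeast_iff, ← forall_lt_iff_le]
    refine forall₂_congr fun β hβ => ?_
    have key : (∃ y ∈ s.extensions,
        WidthAtLeast β {z ∈ s.extensions | IncompRel (· ≤ ·) y z}) ↔
        ∃ y, ∃ hy : y ∈ s.extensions, β ≤ IsWellFounded.rank Below (s.snoc y hy) := by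
      refine exists_congr fun y => ?_
      rw [← exists_prop]
      exact exists_congr fun hy => by rw [← ih β hβ, extensions_snoc]
    rw [key]
    constructor
    · rintro ⟨y, hy, hle⟩
      exact hle.trans_lt (IsWellFounded.rank_lt_of_rel (snoc_below s y hy))
    · intro hlt
      rw [IsWellFounded.rank_eq, Ordinal.lt_iSup_iff] at hlt
      obtain ⟨⟨t, ht⟩, hβt⟩ := hlt
      obtain ⟨y, hy, rfl | hbel⟩ := ht.exists_snoc
      · exact ⟨y, hy, Order.lt_succ_iff.1 hβt⟩
      · exact ⟨y, hy, (Order.lt_succ_iff.1 hβt).trans (IsWellFounded.rank_lt_of_rel hbel).le⟩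

end AntichainSeq

theorem widthAtLeast_univ_iff {A : Type u} [Preorder A] [WellQuasiOrderedLE A]
    {α : Ordinal.{u}} : WidthAtLeast α (Set.univ : Set A) ↔ α ≤ width A := by
  rw [width, ← AntichainSeq.widthAtLeast_extensions_iff]
  suffices (AntichainSeq.root A).extensions = Set.univ by rw [this]
  exact Set.eq_univ_of_forall fun y x hx => absurd hx List.not_mem_nil

/-! ### Finite subsets under Hoare embedding -/

namespace Pf

variable {A : Type u}

/-- The finite subsets of a set `C`. -/
def within (C : Set A) : Set (Pf A) :=
  {S | ∀ a ∈ S, a ∈ C}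

/-- The union of two finite sets, as elements of the finitary powerset. -/
noncomputable def union (S T : Pf A) : Pf A :=
  open Classical in ((S : Finset A) ∪ (T : Finset A) : Finset A)

theorem mem_union {S T : Pf A} {a : A} : a ∈ union S T ↔ a ∈ S ∨ a ∈ T := by
  classical
  exact Finset.mem_union (s := (S : Finset A)) (t := (T : Finset A))

variable [Preorder A]

/-- Joining to all members a fixed set `U` below which none of their elements lie preserves lower
bounds on the width. -/
theorem widthAtLeast_union {α : Ordinal.{v}} {C : Set A} {K : Set (Pf A)} (U : Pf A)
    (h : WidthAtLeast α (within C)) (hU : ∀ a ∈ C, ∀ u ∈ U, ¬ a ≤ u)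
    (hK : ∀ S ∈ within C, union U S ∈ K) : WidthAtLeast α K := by
  have key : ∀ S ∈ within C, ∀ T, union U S ≤ union U T → S ≤ T := fun S hS T hle a ha => by
    obtain ⟨b, hb, hab⟩ := hle a (mem_union.2 (Or.inr ha))
    rcases mem_union.1 hb with hb | hb
    · exact absurd hab (hU a (hS a ha) b hb)
    · exact ⟨b, hb, hab⟩
  exact h.map (union U) hK fun S hS T hT hST =>
    ⟨fun hle => hST.1 (key S hS T hle), fun hle => hST.2 (key T hT S hle)⟩

/-- If `X` is an antichain in `C`, and the finite subsets of a set `D ⊆ C` of elements incomparable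
to `X` have width at least `α`, then the finite subsets of `C` have width at least `α · |X|`: the
sets that consist of one element of `X` and of elements of `D` fall into `|X|` mutually
incomparable classes. -/
theorem widthAtLeast_mul_card {α : Ordinal.{v}} {C D : Set A}
    (hD : WidthAtLeast α (within D)) (hDC : D ⊆ C) (X : Finset A) (hXC : ↑X ⊆ C)
    (hX : (X : Set A).Pairwise (IncompRel (· ≤ ·)))
    (hXD : ∀ x ∈ X, ∀ y ∈ D, IncompRel (· ≤ ·) x y) :
    WidthAtLeast (α * X.card) (within C) := by
  classical
  let K : Finset A → Set (Pf A) := fun Y =>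
    {S | ∃ x ∈ Y, ∃ T ∈ within D, S = union ({x} : Finset A) T}
  have hmem : ∀ x : A, x ∈ (({x} : Finset A) : Pf A) := fun x => Finset.mem_singleton_self x
  have heq : ∀ x y : A, y ∈ (({x} : Finset A) : Pf A) → y = x := fun x y => Finset.mem_singleton.1
  have key : ∀ Y ⊆ X, WidthAtLeast (α * Y.card) (K Y) := by
    intro Y
    induction Y using Finset.induction_on with
    | empty => intro _; simpa using WidthAtLeast.zero _
    | insert x Y hx ih =>
      intro hYX
      rw [Finset.insert_subset_iff] at hYX
      rw [Finset.card_insert_of_notMem hx, Nat.cast_succ, mul_add, mul_one]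
      have hE : WidthAtLeast α (K {x}) := widthAtLeast_union ({x} : Finset A) hD
        (fun a ha y hy => by rw [heq x y hy]; exact (hXD x hYX.1 a ha).2)
        fun T hT => ⟨x, Finset.mem_singleton_self x, T, hT, rfl⟩
      refine hE.add ?_ fun G _ hG => (ih hYX.2).mono ?_
      · rintro _ ⟨y, hy, T, hT, rfl⟩
        rw [Finset.mem_singleton.1 hy]
        exact ⟨x, Finset.mem_insert_self _ _, T, hT, rfl⟩
      · rintro _ ⟨y, hy, T, hT, rfl⟩
        refine ⟨⟨y, Finset.mem_insert_of_mem hy, T, hT, rfl⟩, fun S hS => ?_⟩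
        obtain ⟨z, hz, T', hT', rfl⟩ := hG hS
        rw [Finset.mem_singleton.1 hz]
        have hle : ∀ a ∈ X, ∀ b ∈ X, a ≠ b → ∀ U V, V ∈ within D →
            ¬ union ({a} : Finset A) U ≤ union ({b} : Finset A) V := by
          intro a ha b hb hab U V hV hle
          obtain ⟨c, hc, hac⟩ := hle a (mem_union.2 (Or.inl (hmem a)))
          rcases mem_union.1 hc with hc | hc
          · rw [heq b c hc] at hac
            exact (hX ha hb hab).1 hac
          · exact (hXD a ha c (hV c hc)).1 hac
        have hxy : x ≠ y := fun h => hx (h ▸ hy)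
        exact ⟨hle x hYX.1 y (hYX.2 hy) hxy _ _ hT, hle y (hYX.2 hy) x hYX.1 hxy.symm _ _ hT'⟩
  refine (key X subset_rfl).mono ?_
  rintro _ ⟨x, hx, T, hT, rfl⟩ a ha
  rcases mem_union.1 ha with ha | ha
  · rw [heq x a ha]; exact hXC hx
  · exact hDC (hT a ha)

/-- An induction on `a`, whose successor step applies `Pf.widthAtLeast_mul_card` to antichains of
every finite size. -/
theorem widthAtLeast_omega0_opow {a : Ordinal.{v}} {C : Set A}
    (h : WidthAtLeast (Ordinal.omega0 * a) C) :
    WidthAtLeast (Ordinal.omega0 ^ a) (within C) := by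
  induction a using Ordinal.limitRecOn generalizing C with
  | zero =>
    rw [Ordinal.opow_zero]
    refine widthAtLeast_iff.2 fun β hβ => ⟨(∅ : Finset A), fun a ha => ?_, ?_⟩
    · exact absurd ha (Finset.notMem_empty a)
    · rw [Order.lt_one_iff.1 hβ]
      exact WidthAtLeast.zero _
  | add_one b ih =>
    rw [mul_add, mul_one] at h
    refine WidthAtLeast.of_forall_succ fun β hβ => ?_
    rw [← Order.succ_eq_add_one, Ordinal.opow_succ,
      Ordinal.lt_mul_iff_of_isSuccLimit Ordinal.isSuccLimit_omega0] at hβ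
    obtain ⟨n, hn, hβ⟩ := hβ
    obtain ⟨n, rfl⟩ := Ordinal.lt_omega0.1 hn
    obtain ⟨X, rfl, hXC, hX, hD⟩ := (h.anti (β := Ordinal.omega0 * b + n)
      (by gcongr)).exists_antichain
    exact (widthAtLeast_mul_card (ih hD) (fun y hy => hy.1) X hXC hX
      fun x hx y hy => hy.2 x hx).anti (Order.succ_le_of_lt hβ)
  | limit b hb ih =>
    refine WidthAtLeast.of_forall_succ fun β hβ => ?_
    obtain ⟨c, hc, hβ⟩ := (Ordinal.lt_opow_of_isSuccLimit Ordinal.omega0_ne_zero hb).1 hβ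
    exact (ih c hc (h.anti (by gcongr))).anti (Order.succ_le_of_lt hβ)

/-- Let `X` be an antichain, and let `D` be a set of elements incomparable to `X` that keeps a
width of at least `ω · a`, where `a ≠ 0`, when the cones below finitely many of its elements are
removed. The sets `Y ∪ T` with `Y ∈ 𝒴`, a family of subsets of `X`, and with `T` a finite subset
of `D`, then have width at least `ω ^ a · |𝒴|`. The induction on `|𝒴|` requires `T` to have an
element outside the lower closure of a given finite set `F`, which records the elements of `D`
played so far. -/
theorem widthAtLeast_mul_card_family {a : Ordinal.{v}} (ha : a ≠ 0) {D : Set A} (X : Finset A)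
    (hX : (X : Set A).Pairwise (IncompRel (· ≤ ·)))
    (hXD : ∀ x ∈ X, ∀ y ∈ D, IncompRel (· ≤ ·) x y)
    (hD : ∀ F : Finset A, ↑F ⊆ D →
      WidthAtLeast (Ordinal.omega0 * a) {x ∈ D | ∀ t ∈ F, ¬ x ≤ t})
    (𝒴 : Finset (Finset A)) (h𝒴 : ∀ Y ∈ 𝒴, Y ⊆ X) (F : Finset A) (hF : ↑F ⊆ D) :
    WidthAtLeast (Ordinal.omega0 ^ a * 𝒴.card)
      {S : Pf A | ∃ Y ∈ 𝒴, ∃ T ∈ within D, (∃ s ∈ T, ∀ t ∈ F, ¬ s ≤ t) ∧ S = union Y T} := by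
  classical
  induction h : 𝒴.card generalizing 𝒴 F with
  | zero => simpa using WidthAtLeast.zero _
  | succ n ih =>
    obtain ⟨Y, hmax⟩ := 𝒴.exists_maximal (Finset.card_pos.1 (by omega))
    have hY := hmax.1
    have hcard : (𝒴.erase Y).card = n := by rw [Finset.card_erase_of_mem hY, h]; rfl
    have hpos : (0 : Ordinal.{v}) < Ordinal.omega0 * a :=
      mul_pos Ordinal.omega0_pos (pos_iff_ne_zero.2 ha)
    obtain ⟨t, ⟨htD, htF⟩, -⟩ := widthAtLeast_iff.1 (hD F hF) 0 hpos
    -- `T ↦ Y ∪ {t} ∪ T` reflects the order on the finite sets `T` outside the cone below `t`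
    have ht := widthAtLeast_omega0_opow (hD {t} (by simpa using htD))
    rw [Nat.cast_succ, mul_add, mul_one]
    -- the first part of the antichain is played among the sets `Y ∪ {t} ∪ T`
    have hE : WidthAtLeast (Ordinal.omega0 ^ a)
        {S : Pf A | ∃ T ∈ within D, t ∈ T ∧ S = union Y T} := by
      refine widthAtLeast_union (union Y ({t} : Finset A)) ht ?_ ?_
      · intro x hx u hu hxu
        rcases mem_union.1 hu with hu | hu
        · exact (hXD u (h𝒴 Y hY hu) x hx.1).2 hxu
        · rw [Finset.mem_singleton.1 hu] at hxu
          exact hx.2 t (Finset.mem_singleton_self t) hxu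
      · intro T hT
        refine ⟨union ({t} : Finset A) T, fun x hx => ?_,
          mem_union.2 (Or.inl (Finset.mem_singleton_self t)), ?_⟩
        · rcases mem_union.1 hx with hx | hx
          · rwa [Finset.mem_singleton.1 hx]
          · exact (hT x hx).1
        · exact Finset.union_assoc (Y : Finset A) {t} (T : Finset A)
    refine hE.add ?_ fun G hG hGE => ?_
    · rintro _ ⟨T, hT, htT, rfl⟩
      exact ⟨Y, hY, T, hT, ⟨t, htT, htF⟩, rfl⟩
    · -- afterwards every set has to contain an element of `D` below no element used so far
      have hU : (⋃ S ∈ G, {x | x ∈ S ∧ x ∈ D}).Finite :=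
        hG.biUnion fun S _ => (Finset.finite_toSet (show Finset A from S)).subset fun x hx => hx.1
      have hF' : ↑(F ∪ hU.toFinset) ⊆ D := by
        intro x hx
        rw [Finset.coe_union, Set.Finite.coe_toFinset] at hx
        rcases hx with hx | hx
        · exact hF hx
        · obtain ⟨S, -, hx⟩ := Set.mem_iUnion₂.1 hx
          exact hx.2
      refine (ih (𝒴.erase Y) (fun Z hZ => h𝒴 Z (Finset.mem_of_mem_erase hZ)) _ hF' hcard).mono ?_
      rintro _ ⟨Z, hZ, T, hT, ⟨s, hsT, hs⟩, rfl⟩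
      have hZ' := Finset.mem_of_mem_erase hZ
      refine ⟨⟨Z, hZ', T, hT, ⟨s, hsT, fun x hx => hs x (Finset.mem_union_left _ hx)⟩, rfl⟩,
        fun S hS => ?_⟩
      obtain ⟨T', hT', htT', rfl⟩ := hGE hS
      constructor
      · -- by maximality, `Y` has an element outside `Z`
        intro hle
        have hYZ : Y ⊆ Z := fun y hy => by
          obtain ⟨b, hb, hyb⟩ := hle y (mem_union.2 (Or.inl hy))
          rcases mem_union.1 hb with hbZ | hbT
          · by_contra hyZ
            exact (hX (h𝒴 Y hY hy) (h𝒴 Z hZ' hbZ) fun e => hyZ (e ▸ hbZ)).1 hyb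
          · exact absurd hyb (hXD y (h𝒴 Y hY hy) b (hT b hbT)).1
        exact Finset.ne_of_mem_erase hZ ((hmax.2 hZ' hYZ).antisymm hYZ)
      · intro hle
        obtain ⟨b, hb, hsb⟩ := hle s (mem_union.2 (Or.inr hsT))
        rcases mem_union.1 hb with hbY | hbT
        · exact (hXD b (h𝒴 Y hY hbY) s (hT s hsT)).2 hsb
        · exact hs b (Finset.mem_union_right _ (hU.mem_toFinset.2
            (Set.mem_iUnion₂.2 ⟨_, hS, hb, hT' b hbT⟩))) hsb

end Pf

/-! ### Lower bounds on the width of the powerset -/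

theorem two_opow_width_le_width_pf (A : Type u) [Preorder A] [WellQuasiOrderedLE A]
    (h : Ordinal.omega0 ≤ width A) : (2 : Ordinal.{u}) ^ width A ≤ width (Pf A) := by
  have hdiv : width A / Ordinal.omega0 ≠ 0 :=
    ((Ordinal.div_pos Ordinal.omega0_ne_zero).2 h).ne'
  obtain ⟨n, hn⟩ := Ordinal.lt_omega0.1 (Ordinal.mod_lt (width A) Ordinal.omega0_ne_zero)
  have hdm := Ordinal.div_add_mod (width A) Ordinal.omega0
  rw [hn] at hdm
  generalize width A / Ordinal.omega0 = a at hdiv hdm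
  have hw : (2 : Ordinal.{u}) ^ width A = Ordinal.omega0 ^ a * (2 ^ n : ℕ) := by
    rw [← hdm, Ordinal.opow_add, Ordinal.opow_mul, Ordinal.opow_natCast, Ordinal.natCast_pow]
    congr 2
    exact Ordinal.natCast_opow_omega0 one_lt_two
  obtain ⟨X, hcard, -, hX, hC⟩ :=
    (widthAtLeast_univ_iff.2 hdm.le : WidthAtLeast _ (Set.univ : Set A)).exists_antichain
  obtain ⟨D, hDC, hD⟩ := hC.exists_diff_lowerClosure 
    (Ordinal.isSuccLimit_mul_left Ordinal.isSuccLimit_omega0 (pos_iff_ne_zero.2 hdiv))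
  rw [hw, ← hcard, ← Finset.card_powerset, ← widthAtLeast_univ_iff]
  exact (Pf.widthAtLeast_mul_card_family hdiv X hX (fun x hx y hy => (hDC hy).2 x hx) hD
    X.powerset (fun Y => Finset.mem_powerset.1) ∅ (by simp)).mono (Set.subset_univ _)

theorem width_pf_gam_le (A : Type u) [Preorder A] [WellQuasiOrderedLE A] (k : ℕ)
    (h : width A = k) : Ordinal.lift.{u} (width (Pf (Gam k))) ≤ width (Pf A) := by
  classical
  have hA : WidthAtLeast (0 + (k : Ordinal.{u})) (Set.univ : Set A) :=
    widthAtLeast_univ_iff.2 (by rw [zero_add, h])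
  obtain ⟨X, hcard, -, hX, -⟩ := hA.exists_antichain
  let e : Gam k ≃ X := (X.equivFinOfCardEq hcard).symm
  let f : Pf (Gam k) → Pf A := fun S => Finset.image (fun i => (e i : A)) S
  have hmem : ∀ S a, a ∈ f S ↔ ∃ i ∈ S, (e i : A) = a := fun S a => Finset.mem_image
  have hf : ∀ S T, f S ≤ f T → S ≤ T := by
    intro S T hle i hi
    obtain ⟨b, hb, hib⟩ := hle (e i) ((hmem S _).2 ⟨i, hi, rfl⟩)
    obtain ⟨j, hj, rfl⟩ := (hmem T b).1 hb
    refine ⟨j, hj, by_contra fun hij => ?_⟩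
    exact (hX (e i).2 (e j).2 fun he => hij (e.injective (Subtype.ext he)).le).1 hib
  rw [← widthAtLeast_univ_iff]
  exact (WidthAtLeast.lift (widthAtLeast_univ_iff.2 le_rfl)).map f (fun _ _ => Set.mem_univ _)
    fun S _ T _ hST => ⟨fun hle => hST.1 (hf S T hle), fun hle => hST.2 (hf T S hle)⟩

/-! ### The sums `ℕ ⊕ α` -/

open Ordinal in
/-- The width of `ℕ × α` is at most `α`. After a first element `(n, β)`, there remain the elements
right of it and below it, of width at most `β` by induction, and a grid with `n` columns and rows
`γ` for `β < γ < α`. The grid is covered by its columns and by its rows; removing whichever is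
suitable leaves a contradiction. -/
theorem WidthAtLeast.le_of_nat_prod {α γ : Ordinal.{v}}
    (h : WidthAtLeast γ {x : ℕ × Ordinal.{v} | x.2 < α}) : γ ≤ α := by
  induction α using WellFoundedLT.induction generalizing γ with
  | ind α ih =>
    by_contra! hlt
    obtain ⟨⟨n, β⟩, hβ, hx⟩ := widthAtLeast_iff.1 h α hlt
    have hβ : β < α := hβ
    have hrest : ¬ WidthAtLeast (Order.succ β) {y : ℕ × Ordinal.{v} | y.2 < β} := fun hy =>
      (Order.lt_succ β).not_ge (ih β hβ hy)
    -- either the `n` columns or the rows of the grid are few compared with `α`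
    rcases le_or_gt (β + ω) α with hle | hgt
    · have hlt' : Order.succ β + n ≤ α := by
        refine (lt_of_lt_of_le ?_ hle).le
        rw [Order.succ_eq_add_one, add_assoc, add_lt_add_iff_left]
        exact_mod_cast natCast_lt_omega0 (1 + n)
      refine hrest (((hx.anti hlt').diff_iUnion_chain (fun i => {y | y.1 = i}) ?_ n).mono ?_)
      · rintro i ⟨a, b⟩ rfl ⟨c, d⟩ hc ⟨h1, h2⟩
        cases hc
        rcases le_total b d with hbd | hbd
        exacts [h1 ⟨le_rfl, hbd⟩, h2 ⟨le_rfl, hbd⟩]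
      · rintro ⟨m, δ⟩ ⟨⟨-, h1, h2⟩, hm⟩
        have hnm : n ≤ m := by
          by_contra! hmn
          exact hm (Set.mem_iUnion₂.2 ⟨m, hmn, rfl⟩)
        exact not_le.1 fun hle => h1 ⟨hnm, hle⟩
    · obtain ⟨δ, rfl⟩ := exists_add_of_le (Order.succ_le_of_lt hβ)
      rw [Order.succ_eq_add_one, add_assoc, add_lt_add_iff_left] at hgt
      obtain ⟨k, rfl⟩ := lt_omega0.1 ((le_add_self : δ ≤ 1 + δ).trans_lt hgt)
      refine hrest ((hx.diff_iUnion_chain (fun i => {y | y.2 = Order.succ β + i}) ?_ k).mono ?_)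
      · rintro i ⟨a, b⟩ rfl ⟨c, d⟩ hc ⟨h1, h2⟩
        cases hc
        rcases le_total a c with hbd | hbd
        exacts [h1 ⟨hbd, le_rfl⟩, h2 ⟨hbd, le_rfl⟩]
      · rintro ⟨m, δ⟩ ⟨⟨hδ, h1, h2⟩, hm⟩
        have hδ : δ < Order.succ β + k := hδ
        show δ < β
        by_contra! hβδ
        rcases hβδ.eq_or_lt with rfl | hβδ
        · rcases le_total n m with hnm | hnm
          exacts [h1 ⟨hnm, le_rfl⟩, h2 ⟨hnm, le_rfl⟩]
        · obtain ⟨ε, rfl⟩ := exists_add_of_le (Order.succ_le_of_lt hβδ)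
          have hε : ε < k := (add_lt_add_iff_left _).1 hδ
          obtain ⟨i, rfl⟩ := lt_omega0.1 (hε.trans (natCast_lt_omega0 k))
          exact hm (Set.mem_iUnion₂.2 ⟨i, by exact_mod_cast hε, rfl⟩)

theorem widthAtLeast_nat_prod (α : Ordinal.{v}) (n : ℕ) :
    WidthAtLeast α {x : ℕ × Ordinal.{v} | n ≤ x.1 ∧ x.2 < α} := by
  induction α using WellFoundedLT.induction generalizing n with
  | ind α ih =>
    refine widthAtLeast_iff.2 fun β hβ => ⟨(n, β), ⟨le_rfl, hβ⟩, (ih β hβ (n + 1)).mono ?_⟩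
    rintro ⟨m, δ⟩ ⟨hm, hδ⟩
    exact ⟨⟨(Nat.lt_of_succ_le hm).le, hδ.trans hβ⟩, fun h => hδ.not_ge h.2,
      fun h => (Nat.lt_of_succ_le hm).not_ge h.1⟩

theorem width_nat_sum_toType {α : Ordinal.{u}} (h : Ordinal.omega0 ≤ α) :
    width (ℕ ⊕ α.ToType) = 2 := by
  have hne : Nonempty α.ToType :=
    Ordinal.nonempty_toType_iff.2 (Ordinal.omega0_pos.trans_le h).ne'
  have hinc : ∀ (n : ℕ) (a : α.ToType), IncompRel (· ≤ ·) (Sum.inl n) (Sum.inr a) :=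
    fun _ _ => ⟨Sum.not_inl_le_inr, Sum.not_inr_le_inl⟩
  apply le_antisymm
  · by_contra! hlt
    have h3 : WidthAtLeast ((1 : Ordinal.{u}) + (2 : ℕ)) (Set.univ : Set (ℕ ⊕ α.ToType)) :=
      widthAtLeast_univ_iff.2 (le_trans (by norm_num) (Order.succ_le_of_lt hlt))
    obtain ⟨x, ⟨-, hx⟩, -⟩ := widthAtLeast_iff.1 (h3.diff_iUnion_chain
      (fun i => if i = 0 then Set.range Sum.inl else Set.range Sum.inr) (fun i => by
        split_ifs
        · rintro _ ⟨a, rfl⟩ _ ⟨b, rfl⟩ ⟨h1, h2⟩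
          rcases le_total a b with hab | hab
          exacts [h1 (Sum.inl_le_inl_iff.2 hab), h2 (Sum.inl_le_inl_iff.2 hab)]
        · rintro _ ⟨a, rfl⟩ _ ⟨b, rfl⟩ ⟨h1, h2⟩
          rcases le_total a b with hab | hab
          exacts [h1 (Sum.inr_le_inr_iff.2 hab), h2 (Sum.inr_le_inr_iff.2 hab)]))
      0 zero_lt_one
    refine hx (Set.mem_iUnion₂.2 ?_)
    rcases x with n | a
    exacts [⟨0, by norm_num, n, rfl⟩, ⟨1, by norm_num, a, rfl⟩]
  · rw [← widthAtLeast_univ_iff]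
    refine widthAtLeast_iff.2 fun β hβ => ⟨Sum.inl 0, Set.mem_univ _, widthAtLeast_iff.2
      fun γ hγ => ⟨Sum.inr hne.some, ⟨Set.mem_univ _, hinc _ _⟩, ?_⟩⟩
    have hβ1 : β < 1 + 1 := by rwa [one_add_one_eq_two]
    rw [Order.lt_one_iff.1 (hγ.trans_le (Order.lt_add_one_iff.1 hβ1))]
    exact WidthAtLeast.zero _

namespace Pf

variable {α : Ordinal.{u}}

/-- The pair of suprema of the two parts of a finite subset of `ℕ ⊕ α`. Elements are numbered from
one, so that zero stands for an empty part. -/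
noncomputable def sups (S : Pf (ℕ ⊕ α.ToType)) : ℕ × Ordinal.{u} :=
  ((S : Finset (ℕ ⊕ α.ToType)).sup (Sum.elim (fun n => n + 1) fun _ => 0),
    (S : Finset (ℕ ⊕ α.ToType)).sup
      (Sum.elim (fun _ => 0) fun a => 1 + (Ordinal.ToType.mk.symm a : Ordinal.{u})))

theorem sups_snd_lt (h : Ordinal.omega0 ≤ α) (S : Pf (ℕ ⊕ α.ToType)) : S.sups.2 < α := by
  refine (Finset.sup_lt_iff (Ordinal.omega0_pos.trans_le h)).2 fun x _ => ?_
  rcases x with n | a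
  · exact Ordinal.omega0_pos.trans_le h
  · exact ((add_lt_add_iff_left 1).2 (Ordinal.ToType.mk.symm a).2).trans_eq
      (Ordinal.one_add_of_omega0_le h)

theorem le_of_sups_le {S T : Pf (ℕ ⊕ α.ToType)} (h : S.sups ≤ T.sups) : S ≤ T := by
  rintro (n | a) hx
  · have hle : n < T.sups.1 := (Finset.le_sup (f := Sum.elim (fun n => n + 1) fun _ => 0)
      hx).trans h.1
    obtain ⟨y, hy, hlt⟩ := Finset.lt_sup_iff.1 hle
    rcases y with m | b
    · exact ⟨_, hy, Sum.inl_le_inl_iff.2 (Nat.lt_succ_iff.1 hlt)⟩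
    · exact absurd hlt (Nat.not_lt_zero n)
  · have hle : 1 + (Ordinal.ToType.mk.symm a : Ordinal.{u}) ≤ T.sups.2 := (Finset.le_sup
      (f := Sum.elim (fun _ => 0)
        fun a => 1 + (Ordinal.ToType.mk.symm a : Ordinal.{u})) hx).trans h.2
    obtain ⟨y, hy, hlt⟩ := (Finset.le_sup_iff (zero_lt_one.trans_le le_self_add)).1 hle
    rcases y with m | b
    · exact absurd hlt (zero_lt_one.trans_le le_self_add).not_ge
    · refine ⟨_, hy, Sum.inr_le_inr_iff.2 ?_⟩
      exact Ordinal.ToType.mk.symm.le_iff_le.1 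
        (Subtype.coe_le_coe.1 ((add_le_add_iff_left (1 : Ordinal.{u})).1 hlt))

theorem width_nat_sum_toType (h : Ordinal.omega0 ≤ α) : width (Pf (ℕ ⊕ α.ToType)) = α := by
  classical
  apply le_antisymm
  · refine WidthAtLeast.le_of_nat_prod ((widthAtLeast_univ_iff.2 le_rfl).map sups
      (fun S _ => S.sups_snd_lt h) fun S _ T _ hST => ?_)
    exact ⟨fun hle => hST.1 (le_of_sups_le hle), fun hle => hST.2 (le_of_sups_le hle)⟩
  · rw [← widthAtLeast_univ_iff]
    have : Nonempty α.ToType :=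
      Ordinal.nonempty_toType_iff.2 (Ordinal.omega0_pos.trans_le h).ne'
    let e : Ordinal.{u} → α.ToType := fun β =>
      if hβ : β < α then Ordinal.ToType.mk ⟨β, hβ⟩ else Classical.arbitrary _
    have he : ∀ β, β < α → ∀ γ, γ < α → e β ≤ e γ → β ≤ γ := by
      intro β hβ γ hγ hle
      simp only [e, dif_pos hβ, dif_pos hγ] at hle
      exact Ordinal.ToType.mk.le_iff_le.1 hle
    let f : ℕ × Ordinal.{u} → Pf (ℕ ⊕ α.ToType) := fun x =>
      ({Sum.inl x.1, Sum.inr (e x.2)} : Finset (ℕ ⊕ α.ToType))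
    have hmem : ∀ x y, y ∈ f x ↔ y = Sum.inl x.1 ∨ y = Sum.inr (e x.2) := fun x y => by
      refine Iff.trans Finset.mem_insert ?_
      rw [Finset.mem_singleton]
    have hf : ∀ x y, x.2 < α → y.2 < α → f x ≤ f y → x ≤ y := by
      intro x y hx hy hle
      constructor
      · obtain ⟨z, hz, hxz⟩ := hle _ ((hmem x _).2 (Or.inl rfl))
        rcases (hmem y z).1 hz with rfl | rfl
        exacts [Sum.inl_le_inl_iff.1 hxz, absurd hxz Sum.not_inl_le_inr]
      · obtain ⟨z, hz, hxz⟩ := hle _ ((hmem x _).2 (Or.inr rfl))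
        rcases (hmem y z).1 hz with rfl | rfl
        exacts [absurd hxz Sum.not_inr_le_inl, he _ hx _ hy (Sum.inr_le_inr_iff.1 hxz)]
    exact (widthAtLeast_nat_prod α 0).map f (fun _ _ => Set.mem_univ _) fun x hx y hy hxy =>
      ⟨fun hle => hxy.1 (hf x y hx.2 hy.2 hle), fun hle => hxy.2 (hf y x hy.2 hx.2 hle)⟩

end Pf

theorem mainTheorem3 :
    (∀ (A : Type u) [Preorder A] [WellQuasiOrderedLE A],
      (Ordinal.omega0 ≤ width A → (2 : Ordinal.{u}) ^ width A ≤ width (Pf A)) ∧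
      (∀ k : ℕ, width A = (k : Ordinal.{u}) →
        Ordinal.lift.{u} (width (Pf (Gam k))) ≤ width (Pf A))) ∧
    (∀ α : Ordinal.{u}, Ordinal.omega0 ≤ α →
      width (ℕ ⊕ α.ToType) = 2 ∧ width (Pf (ℕ ⊕ α.ToType)) = α) ∧
    (¬ ∃ f : Ordinal.{u} → Ordinal.{u},
      ∀ (A : Type u) [Preorder A] [WellQuasiOrderedLE A], width (Pf A) ≤ f (width A)) := by
  refine ⟨fun A _ _ => ⟨two_opow_width_le_width_pf A, width_pf_gam_le A⟩,
    fun α hα => ⟨width_nat_sum_toType hα, Pf.width_nat_sum_toType hα⟩, ?_⟩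
  rintro ⟨f, hf⟩
  have hα : Ordinal.omega0 ≤ max Ordinal.omega0 (Order.succ (f 2)) := le_max_left _ _
  have hle := hf (ℕ ⊕ (max Ordinal.omega0 (Order.succ (f 2))).ToType)
  rw [width_nat_sum_toType hα, Pf.width_nat_sum_toType hα] at hle
  exact (Order.lt_succ (f 2)).not_ge ((le_max_right _ _).trans hle)
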